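/- For $x\in\mathbb R^3$ and $r>0$ let $B_r(x)=\{y\in\mathbb R^3:|x-y|<r\}$. For $\sigma\in[0,1]$ let $L^{\sigma,2}(B_r(x))$ be the space of tempered distributions $f$ on $\mathbb R^3$ with $\operatorname{supp} f\subset\overline{B_r(x)}$ whose Fourier transform is a locally integrable function with $$\|f\|_{\dot H^\sigma(\mathbb R^3)}=\Big(\int_{\mathbb R^3}|\xi|^{2\sigma}|\hat f(\xi)|^2\,d\xi\Big)^{1/2}<\infty .$$ Equip $L^{\sigma,2}(B_r(x))$ with this norm and let $L^{-\sigma,2}(B_r(x))$ be its dual space with the dual norm. A locally integrable function $h$ on $B_r(x)$ is regarded as an element of $L^{-\sigma,2}(B_r(x))$ if there is a bounded linear functional on $L^{\sigma,2}(B_r(x))$ that maps each $\varphi\in C_c^\infty(B_r(x))$ to $\int_{B_r(x)}h\varphi\,dy$; then $\|h\|_{L^{-\sigma,2}(B_r(x))}$ is the norm of this functional, and otherwise $\|h\|_{L^{-\sigma,2}(B_r(x))}=\infty$. **Lemma 4.1.** There is an absolute constant $C>0$ such that for all $\sigma\in[0,1]$, $x_0\in\mathbb R^3$ and $r>0$,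 and every (real- or complex-valued) harmonic function $h$ in $B_{2r}(x_0)$, $$\|h\|_{L^2(B_r(x_0))}\le C\,\Big\|\frac{h}{r^\sigma}\Big\|_{L^{-\sigma,2}(B_{2r}(x_0))}.$$ -/

import Mathlib

open MeasureTheory Metric
open scoped ENNReal NNReal FourierTransform SchwartzMap

/-- Three-dimensional Euclidean space. -/
abbrev E3 : Type := EuclideanSpace ℝ (Fin 3)

/-- The Fourier transform of the tempered distribution `f` on `ℝ³` is the locally integrable
function `g`. -/
def HasFourierDensity (f : 𝓢'(E3, ℂ)) (g : E3 → ℂ) : Prop :=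
  LocallyIntegrable g volume ∧
    ∀ φ : 𝓢(E3, ℂ), HasCompactSupport φ → (𝓕 f) φ = ∫ ξ, g ξ * φ ξ

/-- The weighted Fourier transform `|ξ|^σ g(ξ)`. -/
noncomputable def fourierWeight (σ : ℝ) (g : E3 → ℂ) : E3 → ℂ :=
  fun ξ ↦ ((‖ξ‖ ^ σ : ℝ) : ℂ) * g ξ

/-- The homogeneous Sobolev norm `(∫ |ξ|^{2σ} |𝓕 f (ξ)|² dξ)^{1/2}` of a tempered distribution
on `ℝ³`. It is `∞` if the Fourier transform is not a locally integrable function; otherwise the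
function representing it is unique up to null sets, and the infimum is its weighted norm. -/
noncomputable def homSobolevNorm (σ : ℝ) (f : 𝓢'(E3, ℂ)) : ℝ≥0∞ :=
  ⨅ (g : E3 → ℂ) (_ : HasFourierDensity f g), eLpNorm (fourierWeight σ g) 2 volume

lemma integrable_mul_of_hasCompactSupport {g : E3 → ℂ} (hg : LocallyIntegrable g volume)
    {φ : 𝓢(E3, ℂ)} (hφ : HasCompactSupport φ) : Integrable (fun ξ ↦ g ξ * φ ξ) volume := by
  simpa [mul_comm] using hg.integrable_smul_left_of_hasCompactSupport φ.continuous hφ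

lemma HasFourierDensity.add {f₁ f₂ : 𝓢'(E3, ℂ)} {g₁ g₂ : E3 → ℂ}
    (h₁ : HasFourierDensity f₁ g₁) (h₂ : HasFourierDensity f₂ g₂) :
    HasFourierDensity (f₁ + f₂) (g₁ + g₂) := by
  refine ⟨h₁.1.add h₂.1, fun φ hφ ↦ ?_⟩
  have e : (𝓕 (f₁ + f₂)) φ = (𝓕 f₁) φ + (𝓕 f₂) φ := rfl
  rw [e, h₁.2 φ hφ, h₂.2 φ hφ, ← integral_add
    (integrable_mul_of_hasCompactSupport h₁.1 hφ) (integrable_mul_of_hasCompactSupport h₂.1 hφ)]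
  simp [add_mul]

lemma HasFourierDensity.smul (c : ℂ) {f : 𝓢'(E3, ℂ)} {g : E3 → ℂ}
    (h : HasFourierDensity f g) : HasFourierDensity (c • f) (c • g) := by
  refine ⟨h.1.smul c, fun φ hφ ↦ ?_⟩
  have e : (𝓕 (c • f)) φ = c * (𝓕 f) φ := rfl
  rw [e, h.2 φ hφ, ← integral_const_mul]
  simp [mul_assoc]

lemma hasFourierDensity_zero : HasFourierDensity 0 0 :=
  ⟨locallyIntegrable_zero, fun φ _ ↦ by simp⟩

lemma fourierWeight_add (σ : ℝ) (g₁ g₂ : E3 → ℂ) :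
    fourierWeight σ (g₁ + g₂) = fourierWeight σ g₁ + fourierWeight σ g₂ := by
  ext ξ; simp [fourierWeight, mul_add]

lemma fourierWeight_smul (σ : ℝ) (c : ℂ) (g : E3 → ℂ) :
    fourierWeight σ (c • g) = c • fourierWeight σ g := by
  ext ξ; simp [fourierWeight]; ring

lemma aestronglyMeasurable_fourierWeight (σ : ℝ) {g : E3 → ℂ}
    (hg : LocallyIntegrable g volume) : AEStronglyMeasurable (fourierWeight σ g) volume := by
  refine AEStronglyMeasurable.mul ?_ hg.aestronglyMeasurable
  exact (Complex.measurable_ofReal.comp (measurable_norm.pow_const σ)).aestronglyMeasurable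

lemma homSobolevNorm_lt_top_iff {σ : ℝ} {f : 𝓢'(E3, ℂ)} : homSobolevNorm σ f < ∞ ↔
    ∃ g, HasFourierDensity f g ∧ MemLp (fourierWeight σ g) 2 volume := by
  simp only [homSobolevNorm, iInf_lt_iff, MemLp]
  exact ⟨fun ⟨g, h, h'⟩ ↦ ⟨g, h, aestronglyMeasurable_fourierWeight σ h.1, h'⟩,
    fun ⟨g, h, h'⟩ ↦ ⟨g, h, h'.2⟩⟩

/-- The space `L^{σ,2}(B_r(x))` of all tempered distributions of finite homogeneous Sobolev norm
of order `σ` on `ℝ³` whose support lies in the closed ball of centre `x` and radius `r`. -/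
noncomputable def sobolevBall (σ : ℝ) (x : E3) (r : ℝ) : Submodule ℂ 𝓢'(E3, ℂ) where
  carrier := {f | homSobolevNorm σ f < ∞ ∧ Distribution.dsupport f ⊆ closedBall x r}
  zero_mem' := by
    refine ⟨homSobolevNorm_lt_top_iff.2 ⟨0, hasFourierDensity_zero, ?_⟩, ?_⟩
    · have : fourierWeight σ 0 = 0 := by ext ξ; simp [fourierWeight]
      rw [this]; exact MemLp.zero
    · intro y hy
      rw [Distribution.mem_dsupport_iff] at hy
      exact (hy ∅ (fun _ _ ↦ rfl) isClosed_empty).elim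
  add_mem' := by
    rintro f₁ f₂ ⟨h₁, s₁⟩ ⟨h₂, s₂⟩
    obtain ⟨g₁, d₁, m₁⟩ := homSobolevNorm_lt_top_iff.1 h₁
    obtain ⟨g₂, d₂, m₂⟩ := homSobolevNorm_lt_top_iff.1 h₂
    refine ⟨homSobolevNorm_lt_top_iff.2 ⟨g₁ + g₂, d₁.add d₂, ?_⟩, ?_⟩
    · rw [fourierWeight_add]; exact m₁.add m₂
    · intro y hy
      by_contra hy'
      obtain ⟨t₁, v₁, o₁, y₁⟩ := (Distribution.notMem_dsupport_iff y).1 (fun h ↦ hy' (s₁ h))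
      obtain ⟨t₂, v₂, o₂, y₂⟩ := (Distribution.notMem_dsupport_iff y).1 (fun h ↦ hy' (s₂ h))
      refine (Distribution.notMem_dsupport_iff y).2
        ⟨t₁ ∩ t₂, fun u hu ↦ ?_, o₁.inter o₂, ⟨y₁, y₂⟩⟩ hy
      have e : (f₁ + f₂) u = f₁ u + f₂ u := rfl
      rw [e, v₁ u (hu.trans Set.inter_subset_left), v₂ u (hu.trans Set.inter_subset_right),
        add_zero]
  smul_mem' := by
    rintro c f ⟨h, s⟩
    obtain ⟨g, d, m⟩ := homSobolevNorm_lt_top_iff.1 h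
    refine ⟨homSobolevNorm_lt_top_iff.2 ⟨c • g, d.smul c, ?_⟩, ?_⟩
    · rw [fourierWeight_smul]; exact m.const_smul c
    · refine (Distribution.dsupport_subset_dsupport fun t _ ht u hu ↦ ?_).trans s
      have e : (c • f) u = c * f u := rfl
      rw [e, ht u hu, mul_zero]

/-- The dual norm of a linear functional on `L^{σ,2}(B_r(x))`, with value `∞` if the functional is
unbounded. The functional lies in the dual space `L^{-σ,2}(B_r(x))` iff this norm is finite. -/
noncomputable def dualNorm {σ : ℝ} {x : E3} {r : ℝ} (ℓ : sobolevBall σ x r →ₗ[ℂ] ℂ) : ℝ≥0∞ :=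
  ⨆ (u : sobolevBall σ x r) (_ : homSobolevNorm σ (u : 𝓢'(E3, ℂ)) ≤ 1), ‖ℓ u‖ₑ

/-- The functional `ℓ` on `L^{σ,2}(B_r(x))` is the function `h` on the open ball `B_r(x)`: it acts
as `φ ↦ ∫ h φ` on all smooth `φ` with compact support in that ball. -/
def RepresentedBy {σ : ℝ} {x : E3} {r : ℝ} (ℓ : sobolevBall σ x r →ₗ[ℂ] ℂ) (h : E3 → ℂ) : Prop :=
  LocallyIntegrableOn h (ball x r) volume ∧
    ∀ φ : 𝓢(E3, ℂ), HasCompactSupport φ → tsupport φ ⊆ ball x r →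
      ∀ u : sobolevBall σ x r, (u : 𝓢'(E3, ℂ)) = (φ : 𝓢'(E3, ℂ)) →
        ℓ u = ∫ y in ball x r, h y * φ y

/-- The norm of a function `h` in the dual `L^{-σ,2}(B_r(x))` of `L^{σ,2}(B_r(x))`, with value `∞`
if `h` is not an element of the dual, that is, not represented by any bounded functional. -/
noncomputable def negSobolevNorm (σ : ℝ) (x : E3) (r : ℝ) (h : E3 → ℂ) : ℝ≥0∞ :=
  ⨅ (ℓ : sobolevBall σ x r →ₗ[ℂ] ℂ) (_ : RepresentedBy ℓ h), dualNorm ℓ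

/-!
The mean of a harmonic function `h` against a radial bump of centre `y` is a multiple of `h y`.
For a fixed bump `φ` rescaled to the ball `B_s(y)` this expresses `h y` as the pairing of `h` with
`s⁻³ φ((· - y) / s)`, up to a constant. Scaling of the Fourier transform gives the rescaled bump
`Ḣ^σ` norm `s ^ (3 / 2 - σ)` times that of `φ`, which stays bounded for bounded `σ ≥ 0`. Duality
therefore bounds `|h y|` by `s ^ (-3 / 2 - σ)` times the negative norm of `h`. With `s = r` the
bound holds at every `y ∈ B_r(x₀)`, as `B_r(y) ⊆ B_{2r}(x₀)`; integrate its square over `B_r(x₀)`.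
-/

lemma integral_comp_inv_smul_sub {E F : Type*} [NormedAddCommGroup E] [NormedSpace ℝ E]
    [FiniteDimensional ℝ E] [MeasurableSpace E] [BorelSpace E] [NormedAddCommGroup F]
    [NormedSpace ℝ F] (μ : Measure E) [μ.IsAddHaarMeasure] (u : E → F) {s : ℝ} (hs : 0 ≤ s)
    (y : E) : ∫ z, u (s⁻¹ • (z - y)) ∂μ = s ^ Module.finrank ℝ E • ∫ z, u z ∂μ := by
  rw [integral_sub_right_eq_self (fun z ↦ u (s⁻¹ • z)) y,
    Measure.integral_comp_inv_smul_of_nonneg _ _ hs]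

section IntegrationByParts

variable {E F : Type*} [NormedAddCommGroup E] [InnerProductSpace ℝ E]
  [NormedAddCommGroup F] [NormedSpace ℝ F]

lemma fderiv_comp_norm_sq_apply {f : ℝ → ℝ} {z : E} (hf : DifferentiableAt ℝ f (‖z‖ ^ 2)) (v : E) :
    fderiv ℝ (fun z : E ↦ f (‖z‖ ^ 2)) z v = 2 * deriv f (‖z‖ ^ 2) * inner ℝ z v := by
  have h : HasFDerivAt (fun z : E ↦ f (‖z‖ ^ 2)) _ z :=
    hf.hasDerivAt.comp_hasFDerivAt z (hasStrictFDerivAt_norm_sq z).hasFDerivAt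
  rw [h.fderiv]
  simp
  ring

lemma hasCompactSupport_comp_norm_sq [FiniteDimensional ℝ E] {f : ℝ → ℝ}
    (hf : ∀ t, 1 ≤ t → f t = 0) : HasCompactSupport fun z : E ↦ f (‖z‖ ^ 2) := by
  refine HasCompactSupport.intro (isCompact_closedBall (0 : E) 1) fun z hz ↦ hf _ ?_
  exact one_le_pow₀ (by simpa using (not_le.1 (mt mem_closedBall_zero_iff.2 hz)).le)

variable [FiniteDimensional ℝ E] [MeasurableSpace E] [BorelSpace E]

lemma integral_fderiv_smul_eq_neg {w : E → ℝ} {u : E → F} (hw : ContDiff ℝ 1 w)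
    (hcw : HasCompactSupport w) (hu : ContDiff ℝ 1 u) (v : E) :
    ∫ z, fderiv ℝ w z v • u z = -∫ z, w z • fderiv ℝ u z v := by
  have hw' : Continuous fun z ↦ fderiv ℝ w z v :=
    (hw.continuous_fderiv one_ne_zero).clm_apply continuous_const
  have hu' : Continuous fun z ↦ fderiv ℝ u z v :=
    (hu.continuous_fderiv one_ne_zero).clm_apply continuous_const
  rw [integral_smul_fderiv_eq_neg_fderiv_smul_of_integrable, neg_neg]
  · exact (hw'.smul hu.continuous).integrable_of_hasCompactSupport
      (hcw.fderiv_apply ℝ v).smul_right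
  · exact (hw.continuous.smul hu').integrable_of_hasCompactSupport hcw.smul_right
  · exact (hw.continuous.smul hu.continuous).integrable_of_hasCompactSupport hcw.smul_right
  · exact fun z _ ↦ hw.differentiable one_ne_zero z
  · exact fun z _ ↦ hu.differentiable one_ne_zero z

lemma integral_sum_fderiv_smul_eq_neg {ι : Type*} [Fintype ι] {w : E → ℝ} {X : E → E →L[ℝ] F}
    (hw : ContDiff ℝ 1 w) (hcw : HasCompactSupport w) (hX : ContDiff ℝ 1 X) (b : ι → E) :
    ∫ z, ∑ i, fderiv ℝ w z (b i) • X z (b i) =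
      -∫ z, w z • ∑ i, fderiv ℝ X z (b i) (b i) := by
  have hXb (i : ι) : ContDiff ℝ 1 fun z ↦ X z (b i) := hX.clm_apply contDiff_const
  have hXb' (i : ι) (z : E) : fderiv ℝ (fun z ↦ X z (b i)) z (b i) = fderiv ℝ X z (b i) (b i) := by
    simp [fderiv_clm_apply (hX.differentiable one_ne_zero z) (differentiableAt_const (b i))]
  have hcX (i : ι) : Continuous fun z ↦ fderiv ℝ X z (b i) (b i) :=
    ((hX.continuous_fderiv one_ne_zero).clm_apply continuous_const).clm_apply continuous_const
  simp_rw [Finset.smul_sum]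
  rw [integral_finsetSum, integral_finsetSum, ← Finset.sum_neg_distrib]
  · simp_rw [integral_fderiv_smul_eq_neg hw hcw (hXb _), hXb']
  · exact fun i _ ↦ (hw.continuous.smul (hcX i)).integrable_of_hasCompactSupport hcw.smul_right
  · exact fun i _ ↦ (((hw.continuous_fderiv one_ne_zero).clm_apply continuous_const).smul
      (hXb i).continuous).integrable_of_hasCompactSupport (hcw.fderiv_apply ℝ _).smul_right

lemma integral_deriv_norm_sq_smul_apply_self {ι : Type*} [Fintype ι] {f : ℝ → ℝ}
    {X : E → E →L[ℝ] F} (hf : ContDiff ℝ 1 f)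
    (hcf : HasCompactSupport fun z : E ↦ f (‖z‖ ^ 2)) (hX : ContDiff ℝ 1 X)
    (b : OrthonormalBasis ι ℝ E) :
    (2 : ℝ) • ∫ z, deriv f (‖z‖ ^ 2) • X z z =
      -∫ z : E, f (‖z‖ ^ 2) • ∑ i, fderiv ℝ X z (b i) (b i) := by
  have hw : ContDiff ℝ 1 fun z : E ↦ f (‖z‖ ^ 2) := hf.comp (contDiff_norm_sq ℝ)
  rw [← integral_sum_fderiv_smul_eq_neg hw hcf hX b, ← integral_smul]
  refine integral_congr_ae (.of_forall fun z ↦ ?_)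
  calc (2 : ℝ) • deriv f (‖z‖ ^ 2) • X z z
      = (2 * deriv f (‖z‖ ^ 2)) • X z (∑ i, inner ℝ (b i) z • b i) := by
        rw [b.sum_repr' z, smul_smul]
    _ = ∑ i, fderiv ℝ (fun z : E ↦ f (‖z‖ ^ 2)) z (b i) • X z (b i) := by
        simp_rw [fderiv_comp_norm_sq_apply (hf.differentiable one_ne_zero _), map_sum, map_smul,
          Finset.smul_sum, smul_smul, real_inner_comm z]

end IntegrationByParts

section MeanValue

open InnerProductSpace
open scoped Topology

variable {E F : Type*} [NormedAddCommGroup E] [InnerProductSpace ℝ E] [FiniteDimensional ℝ E]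
  [NormedAddCommGroup F] [NormedSpace ℝ F]

lemma exists_contDiff_eventuallyEq_nhdsSet {n : ℕ} {K : Set E} {h : E → F} (hK : IsClosed K)
    (hh : ∀ z ∈ K, ContDiffAt ℝ n h z) : ∃ H : E → F, ContDiff ℝ n H ∧ H =ᶠ[𝓝ˢ K] h := by
  have hopen : IsOpen {z | ContDiffAt ℝ n h z} := isOpen_iff_eventually.2 fun z hz ↦
    ContDiffAt.eventually (show ContDiffAt ℝ n h z from hz) (by simp)
  obtain ⟨V, hV, hKV, hVh⟩ := normal_exists_closure_subset hK hopen hh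
  obtain ⟨χ, hχ, hχV, -⟩ := exists_contMDiffMap_one_nhds_of_subset_interior (n := n)
    (modelWithCornersSelf ℝ E) hK (by rwa [hV.interior_eq])
  have htsupport : tsupport χ ⊆ closure V :=
    closure_mono fun z hz ↦ by_contra fun hzV ↦ hz (hχV z hzV)
  refine ⟨fun z ↦ χ z • h z, contDiff_iff_contDiffAt.2 fun z ↦ ?_, ?_⟩
  · by_cases hz : z ∈ tsupport χ
    · exact χ.contMDiff.contDiff.contDiffAt.smul (hVh (htsupport hz))
    · refine (contDiffAt_const (c := 0)).congr_of_eventuallyEq ?_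
      filter_upwards [notMem_tsupport_iff_eventuallyEq.1 hz] with w hw
      simp [hw]
  · filter_upwards [hχ] with z hz
    simp [hz]

lemma sum_fderiv_fderiv_comp_add_smul {ι : Type*} [Fintype ι] {H : E → F} (hH : ContDiff ℝ 2 H)
    (b : OrthonormalBasis ι ℝ E) (y : E) (s : ℝ) (z : E) :
    ∑ i, fderiv ℝ (fun z ↦ fderiv ℝ H (y + s • z)) z (b i) (b i) =
      s • Laplacian.laplacian H (y + s • z) := by
  have hD := (hH.fderiv_right (m := 1) (by norm_num)).differentiable one_ne_zero (y + s • z)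
  have hline : HasFDerivAt (fun z : E ↦ y + s • z) (s • ContinuousLinearMap.id ℝ E) z :=
    ((hasFDerivAt_id z).const_smul s).const_add y
  have hcomp : HasFDerivAt (fun z ↦ fderiv ℝ H (y + s • z)) _ z := hD.hasFDerivAt.comp z hline
  rw [hcomp.fderiv, laplacian_eq_iteratedFDeriv_orthonormalBasis H b, Finset.smul_sum]
  simp [iteratedFDeriv_two_apply]

lemma exists_contDiff_deriv_eq {g : ℝ → ℝ} (hg : Continuous g) (hg1 : ∀ t, 1 ≤ t → g t = 0) :
    ∃ f : ℝ → ℝ, ContDiff ℝ 1 f ∧ deriv f = g ∧ ∀ t, 1 ≤ t → f t = 0 := by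
  have hderiv (t : ℝ) : HasDerivAt (fun t ↦ ∫ x in (1 : ℝ)..t, g x) (g t) t :=
    (hg.integral_hasStrictDerivAt 1 t).hasDerivAt
  have hderiv_eq : deriv (fun t ↦ ∫ x in (1 : ℝ)..t, g x) = g := funext fun t ↦ (hderiv t).deriv
  refine ⟨_, contDiff_one_iff_deriv.2 ⟨fun t ↦ (hderiv t).differentiableAt, by rwa [hderiv_eq]⟩,
    hderiv_eq, fun t ht ↦ ?_⟩
  refine intervalIntegral.integral_zero_ae (.of_forall fun x hx ↦ hg1 x ?_)
  exact (Set.uIoc_of_le ht ▸ hx).1.le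

variable [MeasurableSpace E] [BorelSpace E]

lemma hasDerivAt_integral_smul_comp_add_smul {w : E → ℝ} (hw : Continuous w)
    (hcw : HasCompactSupport w) {H : E → F} (hH : ContDiff ℝ 1 H) (y : E) (s : ℝ) :
    HasDerivAt (fun s : ℝ ↦ ∫ z, w z • H (y + s • z))
      (∫ z, w z • fderiv ℝ H (y + s • z) z) s := by
  have hHc := hH.continuous
  have : Continuous (fderiv ℝ H) := hH.continuous_fderiv one_ne_zero
  obtain ⟨C, hC⟩ := ((isCompact_closedBall s 1).prod hcw.isCompact).exists_bound_of_continuousOn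
    (f := fun p : ℝ × E ↦ w p.2 • fderiv ℝ H (y + p.1 • p.2) p.2) (by fun_prop)
  refine (hasDerivAt_integral_of_dominated_loc_of_deriv_le (μ := volume)
    (bound := (tsupport w).indicator fun _ ↦ C) (F := fun (s : ℝ) (z : E) ↦ w z • H (y + s • z))
    (F' := fun (s : ℝ) (z : E) ↦ w z • fderiv ℝ H (y + s • z) z)
    (closedBall_mem_nhds s one_pos) ?_ ?_ ?_ ?_ ?_ ?_).2
  · exact .of_forall fun t ↦ Continuous.aestronglyMeasurable (by fun_prop)
  · exact Continuous.integrable_of_hasCompactSupport (by fun_prop) hcw.smul_right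
  · exact Continuous.aestronglyMeasurable (by fun_prop)
  · refine .of_forall fun z t ht ↦ ?_
    by_cases hz : z ∈ tsupport w
    · simpa [hz] using hC (t, z) ⟨ht, hz⟩
    · simp [hz, image_eq_zero_of_notMem_tsupport hz]
  · exact (integrable_indicator_iff (isClosed_tsupport w).measurableSet).2
      (integrableOn_const hcw.isCompact.measure_lt_top.ne)
  · refine .of_forall fun z t _ ↦ HasDerivAt.const_smul (w z) ?_
    have hline : HasDerivAt (fun t : ℝ ↦ y + t • z) z t := by
      simpa using ((hasDerivAt_id t).smul_const z).const_add y
    exact (hH.differentiable one_ne_zero (y + t • z)).hasFDerivAt.comp_hasDerivAt t hline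

lemma integral_deriv_norm_sq_smul_fderiv_eq_zero {f : ℝ → ℝ} (hf : ContDiff ℝ 1 f)
    (hf1 : ∀ t, 1 ≤ t → f t = 0) {H : E → F} (hH : ContDiff ℝ 2 H) {y : E} {s : ℝ}
    (hΔ : ∀ z ∈ closedBall y |s|, Laplacian.laplacian H z = 0) :
    ∫ z, deriv f (‖z‖ ^ 2) • fderiv ℝ H (y + s • z) z = 0 := by
  have hX : ContDiff ℝ 1 fun z ↦ fderiv ℝ H (y + s • z) :=
    (hH.fderiv_right (m := 1) (by norm_num)).comp (by fun_prop)
  have hdiv := integral_deriv_norm_sq_smul_apply_self hf (hasCompactSupport_comp_norm_sq hf1) hX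
    (stdOrthonormalBasis ℝ E)
  have hzero (z : E) : f (‖z‖ ^ 2) • s • Laplacian.laplacian H (y + s • z) = 0 := by
    rcases le_total ‖z‖ 1 with hz | hz
    · have hmem : y + s • z ∈ closedBall y |s| := by
        simpa [norm_smul] using mul_le_of_le_one_right (abs_nonneg s) hz
      rw [hΔ _ hmem, smul_zero, smul_zero]
    · rw [hf1 _ (one_le_pow₀ hz), zero_smul]
  simp_rw [sum_fderiv_fderiv_comp_add_smul hH, hzero, integral_zero, neg_zero] at hdiv
  exact (smul_eq_zero.1 hdiv).resolve_left two_ne_zero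

variable [CompleteSpace F] {g : ℝ → ℝ} {h : E → F} {y : E} {R : ℝ}

/- The left-hand side is constant in `R`: its derivative is the flux of the gradient through a
radial weight, which by the divergence theorem is a weighted integral of the Laplacian. -/
theorem integral_norm_sq_smul_harmonic_add_smul (hg : Continuous g)
    (hg1 : ∀ t, 1 ≤ t → g t = 0) (hR : 0 ≤ R) (hh : HarmonicOnNhd h (closedBall y R)) :
    ∫ z, g (‖z‖ ^ 2) • h (y + R • z) = (∫ z : E, g (‖z‖ ^ 2)) • h y := by
  obtain ⟨H, hH, hHh⟩ := exists_contDiff_eventuallyEq_nhdsSet (n := 2) isClosed_closedBall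
    fun z hz ↦ (hh z hz).1
  have hEq (z) (hz : z ∈ closedBall y R) : H =ᶠ[𝓝 z] h := hHh.filter_mono (nhds_le_nhdsSet hz)
  have hΔ (z) (hz : z ∈ closedBall y R) : Laplacian.laplacian H z = 0 :=
    (laplacian_congr_nhds (hEq z hz)).eq_of_nhds.trans (hh z hz).2.eq_of_nhds
  obtain ⟨f, hf, hfg, hf1⟩ := exists_contDiff_deriv_eq hg hg1
  have hderiv (s : ℝ) := hasDerivAt_integral_smul_comp_add_smul (w := fun z ↦ g (‖z‖ ^ 2))
    (by fun_prop) (hasCompactSupport_comp_norm_sq hg1) (hH.of_le one_le_two) y s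
  have hderiv_zero : ∀ s ∈ Set.Ico 0 R, ∫ z, g (‖z‖ ^ 2) • fderiv ℝ H (y + s • z) z = 0 :=
    fun s hs ↦ hfg ▸ integral_deriv_norm_sq_smul_fderiv_eq_zero hf hf1 hH fun z hz ↦
      hΔ z (closedBall_subset_closedBall (by rw [abs_of_nonneg hs.1]; exact hs.2.le) hz)
  calc ∫ z, g (‖z‖ ^ 2) • h (y + R • z)
      = ∫ z, g (‖z‖ ^ 2) • H (y + R • z) := by
        refine integral_congr_ae (.of_forall fun z ↦ ?_)
        rcases le_total ‖z‖ 1 with hz | hz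
        · have hmem : y + R • z ∈ closedBall y R := by
            simpa [norm_smul, abs_of_nonneg hR] using mul_le_of_le_one_right hR hz
          simp only [(hEq _ hmem).eq_of_nhds]
        · simp only [hg1 _ (one_le_pow₀ hz), zero_smul]
    _ = ∫ z, g (‖z‖ ^ 2) • H (y + (0 : ℝ) • z) :=
        constant_of_has_deriv_right_zero (fun s _ ↦ (hderiv s).continuousAt.continuousWithinAt)
          (fun s hs ↦ (hderiv_zero s hs ▸ hderiv s).hasDerivWithinAt) R ⟨hR, le_rfl⟩
    _ = (∫ z : E, g (‖z‖ ^ 2)) • h y := by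
        simp only [zero_smul, add_zero, (hEq y (mem_closedBall_self hR)).eq_of_nhds]
        exact integral_smul_const _ _

theorem integral_norm_sq_smul_harmonic (hg : Continuous g)
    (hg1 : ∀ t, 1 ≤ t → g t = 0) (hR : 0 < R) (hh : HarmonicOnNhd h (closedBall y R)) :
    ∫ z, g (‖R⁻¹ • (z - y)‖ ^ 2) • h z =
      (R ^ Module.finrank ℝ E * ∫ z : E, g (‖z‖ ^ 2)) • h y := by
  rw [mul_smul, ← integral_norm_sq_smul_harmonic_add_smul hg hg1 hR.le hh,
    ← integral_comp_inv_smul_sub volume _ hR.le y]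
  simp only [smul_inv_smul₀ hR.ne', add_sub_cancel]

end MeanValue

section Rescaling

variable {E F : Type*} [NormedAddCommGroup E] [NormedAddCommGroup F]

/-- The rescaling `z ↦ φ ((z - y) / s)` of a Schwartz function, which moves the unit ball to the
ball of centre `y` and radius `|s|`. -/
noncomputable def rescale [NormedSpace ℝ E] [NormedSpace ℝ F] (φ : 𝓢(E, F)) (y : E) {s : ℝ}
    (hs : s ≠ 0) : 𝓢(E, F) :=
  SchwartzMap.compSubConstCLM ℝ y <| SchwartzMap.compCLMOfContinuousLinearEquiv ℝ
    (ContinuousLinearEquiv.smulLeft (Units.mk0 s⁻¹ (inv_ne_zero hs))) φ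

lemma rescale_apply [NormedSpace ℝ E] [NormedSpace ℝ F] (φ : 𝓢(E, F)) (y : E) {s : ℝ} (hs : s ≠ 0)
    (z : E) : rescale φ y hs z = φ (s⁻¹ • (z - y)) :=
  rfl

lemma tsupport_rescale_subset [NormedSpace ℝ E] [NormedSpace ℝ F] {φ : 𝓢(E, F)}
    (hφ : ∀ z, 1 ≤ ‖z‖ → φ z = 0) (y : E) {s : ℝ} (hs : 0 < s) :
    tsupport (rescale φ y hs.ne') ⊆ closedBall y s := by
  refine closure_minimal (fun z hz ↦ ?_) isClosed_closedBall
  contrapose! hz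
  rw [Function.notMem_support, rescale_apply]
  refine hφ _ ?_
  rw [norm_smul, norm_inv, Real.norm_of_nonneg hs.le, ← div_eq_inv_mul, one_le_div hs,
    ← dist_eq_norm]
  exact (not_le.1 hz).le

lemma eLpNorm_comp_smul [NormedSpace ℝ E] [FiniteDimensional ℝ E] [MeasurableSpace E]
    [BorelSpace E] (μ : Measure E) [μ.IsAddHaarMeasure] (g : E → F) (p : ℝ≥0∞) {s : ℝ}
    (hs : 0 < s) :
    eLpNorm (fun ξ ↦ g (s • ξ)) p μ =
      ENNReal.ofReal (s ^ (-(Module.finrank ℝ E / p.toReal))) * eLpNorm g p μ := by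
  have hemb := (Homeomorph.smulOfNeZero s hs.ne' : E ≃ₜ E).measurableEmbedding
  have hmap : μ.map (Homeomorph.smulOfNeZero s hs.ne' : E ≃ₜ E) =
      ENNReal.ofReal (s ^ Module.finrank ℝ E)⁻¹ • μ := by
    simpa [abs_of_pos hs] using Measure.map_addHaar_smul μ hs.ne'
  have hpow : ENNReal.ofReal (s ^ Module.finrank ℝ E)⁻¹ ^ (1 / p).toReal =
      ENNReal.ofReal (s ^ (-(Module.finrank ℝ E / p.toReal))) := by
    rw [ENNReal.ofReal_rpow_of_pos (by positivity), ← Real.rpow_natCast, ← Real.rpow_neg hs.le,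
      ← Real.rpow_mul hs.le, one_div, ENNReal.toReal_inv, neg_mul, div_eq_mul_inv]
  calc eLpNorm (fun ξ ↦ g (s • ξ)) p μ
      = eLpNorm g p (μ.map (Homeomorph.smulOfNeZero s hs.ne' : E ≃ₜ E)) :=
        hemb.eLpNorm_map_measure.symm
    _ = _ := by
        rw [hmap, eLpNorm_smul_measure_of_ne_zero (by positivity), hpow, smul_eq_mul]

lemma norm_fourier_comp_inv_smul_sub [InnerProductSpace ℝ E] [FiniteDimensional ℝ E]
    [MeasurableSpace E] [BorelSpace E] [NormedSpace ℂ F] (f : E → F) {s : ℝ} (hs : 0 < s)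
    (y ξ : E) :
    ‖𝓕 (fun v ↦ f (s⁻¹ • (v - y))) ξ‖ = s ^ Module.finrank ℝ E * ‖𝓕 f (s • ξ)‖ := by
  have hphase (v : E) : inner ℝ v ξ = inner ℝ y ξ + inner ℝ (s⁻¹ • (v - y)) (s • ξ) := by
    rw [real_inner_smul_left, real_inner_smul_right, inv_mul_cancel_left₀ hs.ne', inner_sub_left,
      add_sub_cancel]
  have hfourier : 𝓕 (fun v ↦ f (s⁻¹ • (v - y))) ξ =
      s ^ Module.finrank ℝ E • (Real.fourierChar (-inner ℝ y ξ) • 𝓕 f (s • ξ)) := by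
    rw [Real.fourier_eq, Real.fourier_eq, Circle.smul_def, ← integral_smul,
      ← integral_comp_inv_smul_sub volume _ hs.le y]
    refine integral_congr_ae (.of_forall fun v ↦ ?_)
    simp only [hphase v, neg_add, AddChar.map_add_eq_mul, Circle.smul_def, mul_smul]
  rw [hfourier, norm_smul, Circle.norm_smul, Real.norm_of_nonneg (by positivity)]

end Rescaling

section SobolevNorm

variable {σ : ℝ}

lemma hasFourierDensity_schwartz (φ : 𝓢(E3, ℂ)) :
    HasFourierDensity (φ : 𝓢'(E3, ℂ)) (𝓕 φ : 𝓢(E3, ℂ)) := by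
  refine ⟨(𝓕 φ : 𝓢(E3, ℂ)).continuous.locallyIntegrable, fun ψ _ ↦ ?_⟩
  rw [TemperedDistribution.fourier_toTemperedDistributionCLM_eq, SchwartzMap.coe_apply]
  simp [mul_comm]

lemma homSobolevNorm_schwartz_le (σ : ℝ) (φ : 𝓢(E3, ℂ)) :
    homSobolevNorm σ (φ : 𝓢'(E3, ℂ)) ≤
      eLpNorm (fourierWeight σ (𝓕 φ : 𝓢(E3, ℂ))) 2 volume :=
  iInf₂_le _ (hasFourierDensity_schwartz φ)

lemma dsupport_schwartz_subset (φ : 𝓢(E3, ℂ)) :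
    Distribution.dsupport (φ : 𝓢'(E3, ℂ)) ⊆ tsupport φ := by
  intro y hy
  refine (Distribution.mem_dsupport_iff y).1 hy _ (fun u hu ↦ ?_) (isClosed_tsupport _)
  rw [SchwartzMap.coe_apply]
  refine integral_eq_zero_of_ae (.of_forall fun x ↦ ?_)
  by_cases hx : x ∈ tsupport φ
  · simp [image_eq_zero_of_notMem_tsupport fun h ↦ hu h hx]
  · simp [image_eq_zero_of_notMem_tsupport hx]

lemma rpow_le_one_add_sq_rpow {a M : ℝ} (ha : 0 ≤ a) (hσ : 0 ≤ σ) (hσM : σ ≤ M) :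
    a ^ σ ≤ (1 + a ^ 2) ^ M :=
  calc a ^ σ ≤ (1 + a ^ 2) ^ σ := by
        gcongr
        nlinarith [sq_nonneg (a - 1)]
    _ ≤ (1 + a ^ 2) ^ M := Real.rpow_le_rpow_of_exponent_le (by linarith [sq_nonneg a]) hσM

lemma exists_eLpNorm_fourierWeight_le (ψ : 𝓢(E3, ℂ)) (M : ℝ) :
    ∃ K : ℝ≥0, 0 < K ∧ ∀ σ, 0 ≤ σ → σ ≤ M → eLpNorm (fourierWeight σ ψ) 2 volume ≤ K := by
  have hweight : Function.HasTemperateGrowth fun ξ : E3 ↦ (1 + ‖ξ‖ ^ 2) ^ M :=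
    Function.hasTemperateGrowth_one_add_norm_sq_rpow E3 M
  set χ : 𝓢(E3, ℂ) := SchwartzMap.smulLeftCLM ℂ (fun ξ : E3 ↦ (1 + ‖ξ‖ ^ 2) ^ M) ψ
  refine ⟨(eLpNorm χ 2 volume).toNNReal + 1, by positivity, fun σ hσ hσM ↦ ?_⟩
  calc eLpNorm (fourierWeight σ ψ) 2 volume ≤ eLpNorm χ 2 volume := by
        refine eLpNorm_mono fun ξ ↦ ?_
        rw [SchwartzMap.smulLeftCLM_apply_apply hweight, fourierWeight, norm_mul, norm_smul,
          Complex.norm_of_nonneg (by positivity), Real.norm_of_nonneg (by positivity)]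
        gcongr
        exact rpow_le_one_add_sq_rpow (norm_nonneg ξ) hσ hσM
    _ = (eLpNorm χ 2 volume).toNNReal := (ENNReal.coe_toNNReal (χ.memLp 2 volume).2.ne).symm
    _ ≤ _ := by simp

lemma eLpNorm_fourierWeight_rescale (σ : ℝ) (φ : 𝓢(E3, ℂ)) (y : E3) {s : ℝ} (hs : 0 < s) :
    eLpNorm (fourierWeight σ (𝓕 (rescale φ y hs.ne') : 𝓢(E3, ℂ))) 2 volume =
      ENNReal.ofReal (s ^ (3 / 2 - σ)) * eLpNorm (fourierWeight σ (𝓕 φ : 𝓢(E3, ℂ))) 2 volume := by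
  have hfourier (ξ : E3) : ‖𝓕 (rescale φ y hs.ne') ξ‖ = s ^ (3 : ℝ) * ‖𝓕 φ (s • ξ)‖ := by
    have h := norm_fourier_comp_inv_smul_sub φ hs y ξ
    rw [finrank_euclideanSpace_fin, ← Real.rpow_natCast] at h
    exact h
  calc eLpNorm (fourierWeight σ (𝓕 (rescale φ y hs.ne') : 𝓢(E3, ℂ))) 2 volume
      = eLpNorm
          ((s ^ (3 - σ) : ℝ) • fun ξ ↦ fourierWeight σ (𝓕 φ : 𝓢(E3, ℂ)) (s • ξ)) 2 volume := by
        refine eLpNorm_congr_norm_ae (.of_forall fun ξ ↦ ?_)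
        have hnorm (t : ℝ) (ht : 0 ≤ t) : ‖((t ^ σ : ℝ) : ℂ)‖ = t ^ σ :=
          Complex.norm_of_nonneg (by positivity)
        simp only [fourierWeight, Pi.smul_apply, norm_smul, norm_mul, hfourier,
          hnorm ‖ξ‖ (by positivity), hnorm (s * ‖ξ‖) (by positivity), Real.norm_of_nonneg hs.le]
        rw [Real.norm_of_nonneg (by positivity), Real.mul_rpow hs.le (norm_nonneg ξ),
          Real.rpow_sub hs]
        field_simp
    _ = _ := by
        rw [eLpNorm_const_smul, eLpNorm_comp_smul volume _ 2 hs, ← mul_assoc,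
          Real.enorm_of_nonneg (by positivity), ← ENNReal.ofReal_mul (by positivity),
          ← Real.rpow_add hs]
        congr 3
        simp
        ring

lemma exists_homSobolevNorm_rescale_le (φ : 𝓢(E3, ℂ)) (M : ℝ) :
    ∃ K : ℝ≥0, 0 < K ∧ ∀ σ, 0 ≤ σ → σ ≤ M → ∀ (y : E3) (s : ℝ) (hs : 0 < s),
      homSobolevNorm σ (rescale φ y hs.ne' : 𝓢'(E3, ℂ)) ≤ ENNReal.ofReal (s ^ (3 / 2 - σ)) * K := by
  obtain ⟨K, hK, hKφ⟩ := exists_eLpNorm_fourierWeight_le (𝓕 φ) M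
  refine ⟨K, hK, fun σ hσ hσM y s hs ↦ (homSobolevNorm_schwartz_le σ _).trans ?_⟩
  rw [eLpNorm_fourierWeight_rescale σ φ y hs]
  gcongr
  exact hKφ σ hσ hσM

lemma homSobolevNorm_smul_le {c : ℂ} (hc : c ≠ 0) (f : 𝓢'(E3, ℂ)) :
    homSobolevNorm σ (c • f) ≤ ‖c‖ₑ * homSobolevNorm σ f := by
  have hc' : ‖c‖ₑ ≠ 0 := enorm_ne_zero.2 hc
  simp only [homSobolevNorm, ENNReal.mul_iInf_of_ne hc' enorm_ne_top]
  refine le_iInf₂ fun g hg ↦ (iInf₂_le (c • g) (hg.smul c)).trans ?_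
  rw [fourierWeight_smul, eLpNorm_const_smul]

lemma enorm_apply_le_mul_dualNorm {x : E3} {r : ℝ} (ℓ : sobolevBall σ x r →ₗ[ℂ] ℂ)
    {u : sobolevBall σ x r} {A : ℝ≥0} (hA : A ≠ 0)
    (hu : homSobolevNorm σ (u : 𝓢'(E3, ℂ)) ≤ A) : ‖ℓ u‖ₑ ≤ A * dualNorm ℓ := by
  have hnorm : ‖((A⁻¹ : ℝ) : ℂ)‖ₑ = (A : ℝ≥0∞)⁻¹ := by
    rw [← ofReal_norm, Complex.norm_of_nonneg (by positivity),
      ENNReal.ofReal_inv_of_pos (by positivity), ENNReal.ofReal_coe_nnreal]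
  have hunit : homSobolevNorm σ ((((A⁻¹ : ℝ) : ℂ) • u : sobolevBall σ x r) : 𝓢'(E3, ℂ)) ≤ 1 :=
    calc _ ≤ ‖((A⁻¹ : ℝ) : ℂ)‖ₑ * homSobolevNorm σ (u : 𝓢'(E3, ℂ)) :=
          homSobolevNorm_smul_le (by simpa using hA) _
      _ ≤ (A : ℝ≥0∞)⁻¹ * A := by rw [hnorm]; gcongr
      _ = 1 := ENNReal.inv_mul_cancel (by simpa using hA) ENNReal.coe_ne_top
  have hle : ‖ℓ (((A⁻¹ : ℝ) : ℂ) • u)‖ₑ ≤ dualNorm ℓ :=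
    le_iSup₂ (f := fun (v : sobolevBall σ x r)
      (_ : homSobolevNorm σ (v : 𝓢'(E3, ℂ)) ≤ 1) ↦ ‖ℓ v‖ₑ) _ hunit
  rw [map_smul, enorm_smul, hnorm, mul_comm, ← div_eq_mul_inv] at hle
  rw [mul_comm]
  exact (ENNReal.div_le_iff (by simpa using hA) ENNReal.coe_ne_top).1 hle

lemma enorm_setIntegral_mul_le {x : E3} {r : ℝ} (h : E3 → ℂ) {φ : 𝓢(E3, ℂ)}
    (hφ : tsupport φ ⊆ ball x r) {A : ℝ≥0} (hA : A ≠ 0)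
    (hnorm : homSobolevNorm σ (φ : 𝓢'(E3, ℂ)) ≤ A) :
    ‖∫ y in ball x r, h y * φ y‖ₑ ≤ A * negSobolevNorm σ x r h := by
  have hφc := hφ.trans ball_subset_closedBall
  let u : sobolevBall σ x r := ⟨φ, hnorm.trans_lt ENNReal.coe_lt_top,
    (dsupport_schwartz_subset φ).trans hφc⟩
  have hcφ : HasCompactSupport φ :=
    (isCompact_closedBall x r).of_isClosed_subset (isClosed_tsupport φ) hφc
  have hA' : (A : ℝ≥0∞) ≠ 0 := by simpa using hA
  simp only [negSobolevNorm, ENNReal.mul_iInf_of_ne hA' ENNReal.coe_ne_top]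
  refine le_iInf₂ fun ℓ hℓ ↦ ?_
  rw [← hℓ.2 φ hcφ hφ u rfl]
  exact enorm_apply_le_mul_dualNorm ℓ hA hnorm

end SobolevNorm

section UnitBump

/-- The profile `t ↦ exp (-1 / (1 - t))`, extended by zero to `1 ≤ t`, of which `unitBump` is the
radial version. -/
noncomputable def bumpProfile (t : ℝ) : ℝ := expNegInvGlue (1 - t)

lemma contDiff_bumpProfile {n : ℕ∞} : ContDiff ℝ n bumpProfile :=
  expNegInvGlue.contDiff.comp (contDiff_const.sub contDiff_id)

lemma bumpProfile_eq_zero {t : ℝ} (ht : 1 ≤ t) : bumpProfile t = 0 :=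
  expNegInvGlue.zero_of_nonpos (by linarith)

lemma integral_bumpProfile_norm_sq_pos {E : Type*} [NormedAddCommGroup E] [InnerProductSpace ℝ E]
    [FiniteDimensional ℝ E] [MeasurableSpace E] [BorelSpace E] :
    0 < ∫ z : E, bumpProfile (‖z‖ ^ 2) := by
  have hc : Continuous bumpProfile := (contDiff_bumpProfile (n := 0)).continuous
  refine Continuous.integral_pos_of_hasCompactSupport_nonneg_nonzero (x := 0) (by fun_prop)
    (hasCompactSupport_comp_norm_sq fun t ↦ bumpProfile_eq_zero)
    (fun z ↦ expNegInvGlue.nonneg _) ?_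
  simp [bumpProfile]

/-- The test function `z ↦ exp (-1 / (1 - ‖z‖ ^ 2))` on the unit ball, which is tested against
harmonic functions after rescaling. -/
noncomputable def unitBump : 𝓢(E3, ℂ) :=
  HasCompactSupport.toSchwartzMap (f := fun z ↦ (bumpProfile (‖z‖ ^ 2) : ℂ))
    ((hasCompactSupport_comp_norm_sq fun _ ↦ bumpProfile_eq_zero).comp_left Complex.ofReal_zero)
    (Complex.ofRealCLM.contDiff.comp (contDiff_bumpProfile.comp (contDiff_norm_sq ℝ)))

lemma unitBump_apply (z : E3) : unitBump z = (bumpProfile (‖z‖ ^ 2) : ℂ) := rfl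

lemma unitBump_eq_zero (z : E3) (hz : 1 ≤ ‖z‖) : unitBump z = 0 := by
  rw [unitBump_apply, bumpProfile_eq_zero (one_le_pow₀ hz), Complex.ofReal_zero]

lemma setIntegral_harmonic_mul_rescale_unitBump {U : Set E3} {h : E3 → ℂ} {y : E3} {s : ℝ}
    (hs : 0 < s) (hU : closedBall y s ⊆ U) (hh : InnerProductSpace.HarmonicOnNhd h U) :
    ∫ z in U, h z * rescale unitBump y hs.ne' z =
      (s ^ 3 * ∫ z : E3, bumpProfile (‖z‖ ^ 2)) • h y :=
  calc ∫ z in U, h z * rescale unitBump y hs.ne' z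
      = ∫ z, h z * rescale unitBump y hs.ne' z := by
        refine setIntegral_eq_integral_of_forall_compl_eq_zero fun z hz ↦ ?_
        have hz' : z ∉ tsupport (rescale unitBump y hs.ne') :=
          fun h ↦ hz (hU (tsupport_rescale_subset unitBump_eq_zero y hs h))
        rw [image_eq_zero_of_notMem_tsupport hz', mul_zero]
    _ = ∫ z, bumpProfile (‖s⁻¹ • (z - y)‖ ^ 2) • h z := by
        simp only [rescale_apply, unitBump_apply, Complex.real_smul, mul_comm]
    _ = (s ^ 3 * ∫ z : E3, bumpProfile (‖z‖ ^ 2)) • h y := by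
        have hmean := integral_norm_sq_smul_harmonic (contDiff_bumpProfile (n := 0)).continuous
          (fun _ ↦ bumpProfile_eq_zero) hs (hh.mono hU)
        rwa [finrank_euclideanSpace_fin] at hmean

end UnitBump

section Harmonic

open InnerProductSpace

lemma exists_enorm_harmonic_le (M : ℝ) : ∃ D : ℝ≥0, 0 < D ∧ ∀ σ, 0 ≤ σ → σ ≤ M →
    ∀ (x y : E3) (R s : ℝ) (h : E3 → ℂ), 0 < s → closedBall y s ⊆ ball x R →
      HarmonicOnNhd h (ball x R) →
        ‖h y‖ₑ ≤ D * ENNReal.ofReal (s ^ (-(3 / 2) - σ)) * negSobolevNorm σ x R h := by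
  obtain ⟨K, hK, hKσ⟩ := exists_homSobolevNorm_rescale_le unitBump M
  set c : ℝ := ∫ z : E3, bumpProfile (‖z‖ ^ 2)
  have hc : 0 < c := integral_bumpProfile_norm_sq_pos
  refine ⟨K / c.toNNReal, by positivity, fun σ hσ hσM x y R s h hs hsub hh ↦ ?_⟩
  have hpair := enorm_setIntegral_mul_le h
    ((tsupport_rescale_subset unitBump_eq_zero y hs).trans hsub)
    (A := (s ^ (3 / 2 - σ)).toNNReal * K) (by positivity) (hKσ σ hσ hσM y s hs)
  rw [setIntegral_harmonic_mul_rescale_unitBump hs hsub hh, enorm_smul] at hpair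
  have hpow : s ^ (3 / 2 - σ) = s ^ 3 * s ^ (-(3 / 2) - σ) := by
    rw [← Real.rpow_natCast, ← Real.rpow_add hs]
    norm_num
    ring_nf
  have hconst : (((s ^ (3 / 2 - σ)).toNNReal * K : ℝ≥0) : ℝ≥0∞) =
      ‖s ^ 3 * c‖ₑ * ((K / c.toNNReal : ℝ≥0) * ENNReal.ofReal (s ^ (-(3 / 2) - σ))) := by
    rw [Real.enorm_of_nonneg (by positivity), ENNReal.ofReal, ENNReal.ofReal, ← ENNReal.coe_mul,
      ← ENNReal.coe_mul, ENNReal.coe_inj, hpow, Real.toNNReal_mul (by positivity),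
      Real.toNNReal_mul (by positivity)]
    field_simp
  rw [hconst, mul_assoc] at hpair
  have hne : ‖s ^ 3 * c‖ₑ ≠ 0 := enorm_ne_zero.2 (by positivity)
  exact (ENNReal.mul_le_mul_iff_right hne enorm_ne_top).1 hpair

lemma eLpNorm_restrict_ball_le {E F : Type*} [NormedAddCommGroup E] [NormedSpace ℝ E]
    [FiniteDimensional ℝ E] [MeasurableSpace E] [BorelSpace E] [NormedAddCommGroup F]
    (μ : Measure E) [μ.IsAddHaarMeasure] (p : ℝ≥0∞) {x : E} {r : ℝ} (hr : 0 < r) {f : E → F}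
    {B : ℝ≥0∞} (hB : ∀ y ∈ ball x r, ‖f y‖ₑ ≤ B) :
    eLpNorm f p (μ.restrict (ball x r)) ≤
      B * (ENNReal.ofReal (r ^ (Module.finrank ℝ E / p.toReal)) * μ (ball 0 1) ^ p.toReal⁻¹) := by
  have hae : ∀ᵐ y ∂μ.restrict (ball x r), ‖f y‖ₑ ≤ B := by
    filter_upwards [ae_restrict_mem measurableSet_ball] with y hy using hB y hy
  refine (eLpNorm_le_of_ae_enorm_bound hae).trans_eq ?_
  rw [Measure.restrict_apply_univ, Measure.addHaar_ball_of_pos μ x hr, smul_eq_mul,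
    ENNReal.mul_rpow_of_nonneg _ _ (by positivity), ENNReal.ofReal_rpow_of_pos (by positivity),
    ← Real.rpow_natCast, ← Real.rpow_mul hr.le, div_eq_mul_inv]

theorem exists_eLpNorm_harmonic_le (M : ℝ) : ∃ C : ℝ≥0, 0 < C ∧ ∀ σ, 0 ≤ σ → σ ≤ M →
    ∀ (x : E3) (r : ℝ), 0 < r → ∀ h : E3 → ℂ, HarmonicOnNhd h (ball x (2 * r)) →
      ENNReal.ofReal (r ^ σ) * eLpNorm h 2 (volume.restrict (ball x r)) ≤
        C * negSobolevNorm σ x (2 * r) h := by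
  obtain ⟨D, hD, hbound⟩ := exists_enorm_harmonic_le M
  set V : ℝ≥0∞ := volume (ball (0 : E3) 1) ^ (2 : ℝ≥0∞).toReal⁻¹ with hV
  have hV0 : V ≠ 0 := (ENNReal.rpow_pos (measure_ball_pos _ _ one_pos) measure_ball_lt_top.ne).ne'
  have hVtop : V ≠ ∞ := ENNReal.rpow_ne_top_of_nonneg (by positivity) measure_ball_lt_top.ne
  refine ⟨D * V.toNNReal, mul_pos hD (ENNReal.toNNReal_pos hV0 hVtop),
    fun σ hσ hσM x r hr h hh ↦ ?_⟩
  have hpointwise : ∀ y ∈ ball x r,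
      ‖h y‖ₑ ≤ D * ENNReal.ofReal (r ^ (-(3 / 2) - σ)) * negSobolevNorm σ x (2 * r) h :=
    fun y hy ↦ hbound σ hσ hσM x y (2 * r) r h hr
      (closedBall_subset_ball' (by linarith [mem_ball.1 hy])) hh
  have hpow : ENNReal.ofReal (r ^ σ) * ENNReal.ofReal (r ^ (-(3 / 2) - σ)) *
      ENNReal.ofReal (r ^ (3 / 2 : ℝ)) = 1 := by
    rw [← ENNReal.ofReal_mul (by positivity), ← ENNReal.ofReal_mul (by positivity),
      ← Real.rpow_add hr, ← Real.rpow_add hr, ← ENNReal.ofReal_one, ← Real.rpow_zero r]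
    ring_nf
  have hL2 := eLpNorm_restrict_ball_le volume 2 hr hpointwise
  rw [← hV, finrank_euclideanSpace_fin, Nat.cast_ofNat, ENNReal.toReal_ofNat] at hL2
  rw [ENNReal.coe_mul, ENNReal.coe_toNNReal hVtop]
  calc _ ≤ _ := mul_le_mul_right hL2 _
    _ = ENNReal.ofReal (r ^ σ) * ENNReal.ofReal (r ^ (-(3 / 2) - σ)) *
          ENNReal.ofReal (r ^ (3 / 2 : ℝ)) * (D * V * negSobolevNorm σ x (2 * r) h) := by ring
    _ = _ := by rw [hpow, one_mul]

end Harmonic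

theorem lemma4p1_general (M : ℝ) :
    ∃ C : ℝ≥0, 0 < C ∧ ∀ (σ : ℝ), 0 ≤ σ → σ ≤ M → ∀ (x₀ : E3) (r : ℝ), 0 < r →
      ∀ h : E3 → ℂ, InnerProductSpace.HarmonicOnNhd h (ball x₀ (2 * r)) →
        eLpNorm h 2 (volume.restrict (ball x₀ r)) ≤
          C * negSobolevNorm σ x₀ (2 * r) (fun y ↦ h y / ((r ^ σ : ℝ) : ℂ)) := by
  obtain ⟨C, hC, hbound⟩ := exists_eLpNorm_harmonic_le M
  refine ⟨C, hC, fun σ hσ hσM x₀ r hr h hh ↦ ?_⟩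
  have hrσ : 0 < r ^ σ := Real.rpow_pos_of_pos hr σ
  set k : E3 → ℂ := fun y ↦ h y / ((r ^ σ : ℝ) : ℂ)
  have hk : k = (r ^ σ)⁻¹ • h := by
    ext y
    simp [k, div_eq_inv_mul]
  have hhk : h = r ^ σ • k := by rw [hk, smul_inv_smul₀ hrσ.ne']
  calc eLpNorm h 2 (volume.restrict (ball x₀ r))
      = ENNReal.ofReal (r ^ σ) * eLpNorm k 2 (volume.restrict (ball x₀ r)) := by
        rw [hhk, eLpNorm_const_smul, Real.enorm_of_nonneg hrσ.le]
    _ ≤ C * negSobolevNorm σ x₀ (2 * r) k := hbound σ hσ hσM x₀ r hr k (hk ▸ hh.const_smul)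

theorem lemma4p1 :
    ∃ C : ℝ≥0, 0 < C ∧ ∀ (σ : ℝ), 0 ≤ σ → σ ≤ 1 → ∀ (x₀ : E3) (r : ℝ), 0 < r →
      ∀ h : E3 → ℂ, InnerProductSpace.HarmonicOnNhd h (ball x₀ (2 * r)) →
        eLpNorm h 2 (volume.restrict (ball x₀ r)) ≤
          C * negSobolevNorm σ x₀ (2 * r) (fun y ↦ h y / ((r ^ σ : ℝ) : ℂ)) :=
  lemma4p1_general 1
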